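/- An \emph{ordered space} $T=(X,\le,\mathcal T)$ is a set $X$ with a partial order $\le$ and a topology $\mathcal T$ (no relation between them is assumed). For $Y\subseteq X$ write ${\uparrow}Y$, ${\downarrow}Y$ for its up- and down-closure, and ${\uparrow}x={\uparrow}\{x\}$, ${\downarrow}x={\downarrow}\{x\}$. Directed sets are nonempty, and ideals are directed lower sets. Let $\mathcal T^{\le}$ be the topology of all open upper sets; $(X,\mathcal T^{\le})$ is the \emph{upper space} of $T$, and $Y^\circ$ denotes the interior of $Y$ with respect to $\mathcal T^{\le}$. \emph{Order-theoretic notions.} A \emph{domain} is a poset in which every directed subset has a supremum. A domain is \emph{continuous} if for each $x$ there is a least ideal having a join $\geq x$. It is \emph{meet-continuous} if for all $x$ and all directed $D$ with $x\le\bigvee D$, the point $x$ lies in the Scott closure of ${\downarrow}D\cap{\downarrow}x$. The \emph{Scott topology} consists of all upper sets $U$ that meet every directed set having a join in $U$; the \emph{Lawson topology} is generated by the Scott-open sets and the complements of the principal filters ${\uparrow}x$. $T$ is the \emph{Lawson space} of a (continuous, meet-continuous) domain if $(X,\le)$ is such a domain and $\mathcal T$ is its Lawson topology. \emph{Topological notions.}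 A \emph{sober} space is a T$_0$-space whose only irreducible closed sets are the point closures; a \emph{d-space} is a T$_0$-space in which the closure of every directed set (with respect to the specialization order) is a point closure. \emph{Properties of ordered spaces.} $T$ is \begin{itemize} \item a \emph{semi-pospace} if all ${\uparrow}x$ and ${\downarrow}x$ are closed, and a \emph{pospace} if $\le$ is closed in $X\times X$; \item \emph{T$_2$-ordered} if for $x\not\le y$ there are disjoint $U\ni x$ and $V\ni y$ with $U$ an open upper set and $V$ an open lower set; \item \emph{upper T$_3$-ordered} if it is a semi-pospace and for every $x\in O\in\mathcal T^{\le}$ there are $U\in\mathcal T^{\le}$ and a closed upper set $B$ with $x\in U\subseteq B\subseteq O$; \item \emph{hyperconvex} if the sets $U\setminus{\uparrow}F$ with $U\in\mathcal T^{\le}$ and $F$ finite form a base of $\mathcal T$; \item \emph{mc-ordered} if every directed subset, regarded as a net, has a supremum to which it converges; \item \emph{${\uparrow}$-stable} if ${\uparrow}O$ is open for every open $O$; \item \emph{core stable} if ${\uparrow}O=\bigcup\{\mathrm{int}_{\mathcal T}({\uparrow}u):u\in O\}$ for every open $O$; \item \emph{$\curlywedge$-stable} if $Y^\circ=\bigcup\{({\uparrow}y)^\circ:y\in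 Y\}$ for all finite intersections $Y$ of principal filters (including $Y=X$); \item \emph{$\diamondsuit$-stable} if the same equation holds for all $Y$ in the sublattice of the lattice of upper sets that is generated by the principal filters, $\emptyset$ and $X$; \item a \emph{fan space} if it is an ${\uparrow}$-stable semi-pospace in which every point has a neighborhood base of sets of the form ${\uparrow}u\setminus{\uparrow}F$ with $F$ finite. \end{itemize} \textbf{Theorem.} For an ordered space $T$ the following conditions are equivalent: \begin{enumerate} \item[(1)] $T$ is the Lawson space of a continuous domain. \item[(2)] $T$ is a fan space whose upper space is sober; equivalently, $T$ is a fan space whose upper space is a d-space. \item[(3)] $T$ is the Lawson space of a meet-continuous domain, $\curlywedge$-stable and T$_2$. \item[(4)] $T$ is a hyperconvex, mc-ordered, core stable pospace; equivalently, $T$ is a hyperconvex, mc-ordered, core stable semi-pospace. \item[(5)] $T$ is hyperconvex, mc-ordered, ${\uparrow}$-stable, $\diamondsuit$-stable and T$_2$. \end{enumerate} Moreover, in (3) and in (5), `T$_2$' may be replaced by `T$_2$-ordered', by `upper T$_3$-ordered', or by `T$_3$' (that is, regular and T$_1$). -/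

import Mathlib

open Set Filter Topology

namespace OrderedSpace

/-! An ordered space is a type with a partial order and a topology, without any assumed relation
between the two. The notions below are stated for preorders where this costs nothing. -/

section Order

variable (X : Type*) [Preorder X]

/-- Domains (up-complete posets, dcpos): every nonempty directed subset has a least upper bound. -/
def IsDomain : Prop :=
  ∀ D : Set X, D.Nonempty → DirectedOn (· ≤ ·) D → ∃ s, IsLUB D s

/-- Continuous posets: for each `x` there is a least ideal having a join above `x`. -/
def IsContinuousPoset : Prop :=
  ∀ x : X, ∃ I : Order.Ideal X,
    IsLeast {J : Order.Ideal X | ∃ s, IsLUB (J : Set X) s ∧ x ≤ s} I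

/-- Continuous domains: up-complete continuous posets. -/
def IsContinuousDomain : Prop :=
  IsDomain X ∧ IsContinuousPoset X

/-- Meet-continuous domains: if `x ≤ ⋁ D` with `D` directed, then `x` lies in the Scott closure
of `↓D ∩ ↓x`. -/
def IsMeetContinuousDomain : Prop :=
  IsDomain X ∧ ∀ (x : X) (D : Set X), D.Nonempty → DirectedOn (· ≤ ·) D →
    ∀ s, IsLUB D s → x ≤ s →
      x ∈ closure[scott X univ] ((lowerClosure D : Set X) ∩ Iic x)

/-- The finite intersections of principal filters (including the empty intersection `X`). -/
def finiteMeetsOfCores : Set (Set X) :=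
  {Y | ∃ F : Set X, F.Finite ∧ Y = ⋂ a ∈ F, Ici a}

/-- The sublattice of the lattice of upper sets that is generated by the principal filters
together with `∅` and `X`. -/
def latticeOfCores : Set (Set X) :=
  latticeClosure (insert ∅ (insert univ (range (Ici : X → Set X))))

end Order

section Space

/-- d-spaces (monotone convergence spaces): T₀-spaces in which the closure of any directed subset,
with respect to the specialization order (`x ≤ y` iff `x ∈ closure {y}`), is a point closure. -/
def IsDSpace (X : Type*) [TopologicalSpace X] : Prop :=
  T0Space X ∧ ∀ D : Set X, D.Nonempty → DirectedOn (fun x y => x ∈ closure {y}) D →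
    ∃ x, closure D = closure {x}

/-- Sober spaces: T₀-spaces whose only irreducible closed sets are the point closures. -/
def IsSober (X : Type*) [TopologicalSpace X] : Prop :=
  T0Space X ∧ QuasiSober X

end Space

section OrderedSpace

variable (X : Type*) [Preorder X] [TopologicalSpace X]

/-- The topology of all open upper sets. -/
@[reducible]
def upperTopology : TopologicalSpace X where
  IsOpen U := IsOpen U ∧ IsUpperSet U
  isOpen_univ := ⟨isOpen_univ, isUpperSet_univ⟩
  isOpen_inter _ _ h k := ⟨h.1.inter k.1, h.2.inter k.2⟩
  isOpen_sUnion _ h := ⟨isOpen_sUnion fun t ht => (h t ht).1, isUpperSet_sUnion fun t ht => (h t ht).2⟩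

/-- The upper space: the same points with the topology of all open upper sets. -/
def UpperSpace (X : Type*) : Type _ := X

instance instTopologicalSpaceUpperSpace : TopologicalSpace (UpperSpace X) := upperTopology X

/-- The given topology is the Lawson topology of the given order and the order is that of a
continuous domain. -/
def IsLawsonSpaceOfContinuousDomain : Prop :=
  IsContinuousDomain X ∧ Topology.IsLawson X

/-- The given topology is the Lawson topology of the given order and the order is that of a
meet-continuous domain. -/
def IsLawsonSpaceOfMeetContinuousDomain : Prop :=
  IsMeetContinuousDomain X ∧ Topology.IsLawson X

/-- All principal ideals and all principal filters are closed
(for a partial order: semi-pospaces, or T₁-ordered spaces). -/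
def IsSemiPospace : Prop :=
  (∀ x : X, IsClosed (Iic x)) ∧ ∀ x : X, IsClosed (Ici x)

/-- The order relation is closed in the square (for a partial order: pospaces). -/
def IsPospace : Prop :=
  IsClosed {p : X × X | p.1 ≤ p.2}

/-- If `x ≰ y`, there is an open upper set containing `x` and a disjoint open lower set
containing `y`. -/
def IsT2Ordered : Prop :=
  ∀ x y : X, ¬ x ≤ y → ∃ U V : Set X, IsOpen U ∧ IsUpperSet U ∧ IsOpen V ∧ IsLowerSet V ∧
    x ∈ U ∧ y ∈ V ∧ Disjoint U V

/-- Each open upper set `O` containing `x` admits an open upper set `U` and a closed upper set `B`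
with `x ∈ U ⊆ B ⊆ O`. -/
def IsUpperRegular : Prop :=
  ∀ (O : Set X) (x : X), IsOpen O → IsUpperSet O → x ∈ O →
    ∃ U B : Set X, IsOpen U ∧ IsUpperSet U ∧ IsClosed B ∧ IsUpperSet B ∧
      x ∈ U ∧ U ⊆ B ∧ B ⊆ O

/-- Upper regular T₁-ordered spaces. -/
def IsUpperT3Ordered : Prop :=
  IsUpperRegular X ∧ IsSemiPospace X

/-- The sets `U \ ↑F` with `U` an open upper set and `F` finite form a base of the topology. -/
def IsHyperconvex : Prop :=
  TopologicalSpace.IsTopologicalBasis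
    {B : Set X | ∃ U F : Set X, IsOpen U ∧ IsUpperSet U ∧ F.Finite ∧
      B = U \ (upperClosure F : Set X)}

/-- `↑`-stability: up-closures of open sets are open. -/
def IsUpStable : Prop :=
  ∀ O : Set X, IsOpen O → IsOpen (upperClosure O : Set X)

/-- Core stability: `↑O = ⋃ {int (↑u) : u ∈ O}` for each open set `O`. -/
def IsCoreStable : Prop :=
  ∀ O : Set X, IsOpen O → (upperClosure O : Set X) = ⋃ u ∈ O, interior (Ici u)

/-- Stability with respect to a collection `Z` of upper sets: `Y° = ⋃ {(↑y)° : y ∈ Y}` for all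
`Y ∈ Z`, where `°` is the interior operator of the topology of all open upper sets. -/
def IsStableFor (Z : Set (Set X)) : Prop :=
  ∀ Y ∈ Z, @interior X (upperTopology X) Y = ⋃ y ∈ Y, @interior X (upperTopology X) (Ici y)

/-- `⋏`-stability. -/
def IsMeetStable : Prop :=
  IsStableFor X (finiteMeetsOfCores X)

/-- `◇`-stability. -/
def IsDiamondStable : Prop :=
  IsStableFor X (latticeOfCores X)

/-- mc-ordered spaces: every directed subset, regarded as a net, has a supremum to which it
converges. -/
def IsMcOrdered : Prop :=
  ∀ D : Set X, D.Nonempty → DirectedOn (· ≤ ·) D →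
    ∃ s, IsLUB D s ∧ Tendsto (fun d : D => (d : X)) atTop (𝓝 s)

/-- Fan spaces: `↑`-stable spaces with closed principal ideals and filters in which each point has
a neighborhood base of fans `↑u \ ↑F`, where `F` is finite. -/
def IsFanSpace : Prop :=
  IsUpStable X ∧ IsSemiPospace X ∧
    ∀ (x : X), ∀ O ∈ 𝓝 x, ∃ (u : X) (F : Set X), F.Finite ∧
      Ici u \ (upperClosure F : Set X) ∈ 𝓝 x ∧ Ici u \ (upperClosure F : Set X) ⊆ O

end OrderedSpace

end OrderedSpace

/-! Write `A x` for the set of all `u` with `x ∈ (↑u)°`. In the Lawson space of a continuous domain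
the sets `{x | WayBelow u x}` form a base of the open upper sets, so `u ≪ x` gives `u ∈ A x`.
Separation, stability, the fan property and sobriety follow by picking suitable way-below points.

Conversely, suppose the space is hyperconvex, open upper sets are inaccessible by directed joins,
and every `A x` is directed with join `x`. Then members of `A x` are way below `x`, so the domain is
continuous. A Scott-open set around `x` meets `A x`, hence is a neighborhood of `x`; thus the open
upper sets are exactly the Scott-open sets, and hyperconvexity makes the topology the Lawson
topology. This is `isLawsonSpaceOfContinuousDomain_of_exists_mem_interior`.

Fan spaces and core stable spaces supply the points of `A x` inside any neighborhood of `x`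
directly. Under T₂, `isLawsonSpaceOfContinuousDomain_of_t2Space` derives `⋁ A x = x` from stability
for finite unions of cores. For meet-continuous domains that stability comes from
`exists_isOpen_scott_subset_Ici`. -/

namespace OrderedSpace

/-! ### Way-below relation, continuity and meet-continuity. -/

section Order

variable {X : Type*} [PartialOrder X]

/-- The way-below relation. -/
def WayBelow (u x : X) : Prop :=
  ∀ D : Set X, D.Nonempty → DirectedOn (· ≤ ·) D → ∀ s, IsLUB D s → x ≤ s → ∃ d ∈ D, u ≤ d

theorem WayBelow.le {u x : X} (h : WayBelow u x) : u ≤ x := by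
  obtain ⟨d, rfl, hd⟩ := h {x} (singleton_nonempty x) (directedOn_singleton x) x isLUB_singleton le_rfl
  exact hd

theorem WayBelow.trans_le {u x y : X} (h : WayBelow u x) (hxy : x ≤ y) : WayBelow u y :=
  fun D hn hd s hs hy => h D hn hd s hs (hxy.trans hy)

theorem isUpperSet_setOf_wayBelow (u : X) : IsUpperSet {x : X | WayBelow u x} :=
  fun _ _ hxy hx => hx.trans_le hxy

/-- The ideal generated by a nonempty directed set. -/
def idealOfDirected (D : Set X) (hn : D.Nonempty) (hd : DirectedOn (· ≤ ·) D) : Order.Ideal X where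
  toLowerSet := lowerClosure D
  nonempty' := hn.mono subset_lowerClosure
  directed' := by
    rintro a ⟨d, hd1, had⟩ b ⟨e, he1, hbe⟩
    obtain ⟨c, hc, hdc, hec⟩ := hd d hd1 e he1
    exact ⟨c, ⟨c, hc, le_rfl⟩, had.trans hdc, hbe.trans hec⟩

theorem mem_idealOfDirected {D : Set X} {hn : D.Nonempty} {hd : DirectedOn (· ≤ ·) D} {y : X} :
    y ∈ idealOfDirected D hn hd ↔ ∃ d ∈ D, y ≤ d := Iff.rfl

theorem isLUB_idealOfDirected {D : Set X} {hn : D.Nonempty} {hd : DirectedOn (· ≤ ·) D} {s : X}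
    (hs : IsLUB D s) : IsLUB (idealOfDirected D hn hd : Set X) s := by
  refine ⟨?_, fun b hb => hs.2 fun d hd1 => hb ⟨d, hd1, le_rfl⟩⟩
  rintro y ⟨d, hd1, hyd⟩
  exact hyd.trans (hs.1 hd1)

/-- The least ideal with join above `x` is exactly the set of points way below `x`: it is contained
in the ideal generated by any directed set whose join is above `x`. -/
theorem IsContinuousPoset.wayBelow_approx (h : IsContinuousPoset X) (x : X) :
    {u | WayBelow u x}.Nonempty ∧ DirectedOn (· ≤ ·) {u | WayBelow u x} ∧
      IsLUB {u | WayBelow u x} x := by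
  obtain ⟨I, ⟨s, hs, hxs⟩, hmin⟩ := h x
  have hI : (I : Set X) = {u | WayBelow u x} := by
    ext u
    constructor
    · intro hu D hn hd t ht hxt
      exact mem_idealOfDirected.1
        (hmin (a := idealOfDirected D hn hd) ⟨t, isLUB_idealOfDirected ht, hxt⟩ hu)
    · intro hu
      obtain ⟨d, hd, hud⟩ := hu I I.nonempty I.directed s hs hxs
      exact I.lower hud hd
  have hsx : s ≤ x := hs.2 fun u hu => by
    have : u ∈ {u | WayBelow u x} := hI ▸ hu
    exact this.le
  obtain rfl := le_antisymm hsx hxs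
  rw [← hI]
  exact ⟨I.nonempty, I.directed, hs⟩

theorem isContinuousPoset_of_wayBelow_approx
    (h : ∀ x : X, ∃ D : Set X, D.Nonempty ∧ DirectedOn (· ≤ ·) D ∧ IsLUB D x ∧
      ∀ u ∈ D, WayBelow u x) : IsContinuousPoset X := by
  intro x
  obtain ⟨D, hn, hd, hx, hw⟩ := h x
  refine ⟨idealOfDirected D hn hd, ⟨x, isLUB_idealOfDirected hx, le_rfl⟩, ?_⟩
  rintro J ⟨s, hs, hxs⟩ y hy
  obtain ⟨d, hd1, hyd⟩ := mem_idealOfDirected.1 hy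
  obtain ⟨j, hj, hdj⟩ := hw d hd1 J J.nonempty J.directed s hs hxs
  exact J.lower (hyd.trans hdj) hj

theorem IsContinuousPoset.interpolate (h : IsContinuousPoset X) {u x : X} (hu : WayBelow u x) :
    ∃ v, WayBelow u v ∧ WayBelow v x := by
  obtain ⟨⟨v₀, hv₀⟩, hdir, hlub⟩ := h.wayBelow_approx x
  -- The points two way-below steps under `x` are directed with join `x`, so one of them lies above
  -- `u`.
  obtain ⟨w, ⟨v, hwv, hvx⟩, huw⟩ := hu {w | ∃ v, WayBelow w v ∧ WayBelow v x} (by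
      obtain ⟨w, hw⟩ := (h.wayBelow_approx v₀).1
      exact ⟨w, v₀, hw, hv₀⟩) (by
      rintro a ⟨v, hav, hvx⟩ b ⟨v', hbv, hvx'⟩
      obtain ⟨c, hc, hvc, hvc'⟩ := hdir v hvx v' hvx'
      obtain ⟨w, hw, haw, hbw⟩ := (h.wayBelow_approx c).2.1 a (hav.trans_le hvc) b (hbv.trans_le hvc')
      exact ⟨w, ⟨c, hw, hc⟩, haw, hbw⟩) x (by
      constructor
      · rintro w ⟨v, hwv, hvx⟩
        exact hwv.le.trans hvx.le
      · intro b hb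
        exact hlub.2 fun v hv => (h.wayBelow_approx v).2.2.2 fun w hw => hb ⟨v, hw, hv⟩) le_rfl
  refine ⟨v, fun D hn hd s hs hvs => ?_, hvx⟩
  obtain ⟨d, hd1, hwd⟩ := hwv D hn hd s hs hvs
  exact ⟨d, hd1, huw.trans hwd⟩

theorem isOpen_scott_iff {U : Set X} :
    IsOpen[Topology.scott X univ] U ↔ IsUpperSet U ∧ DirSupInacc U := by
  rw [@Topology.IsScott.isOpen_iff_isUpperSet_and_dirSupInaccOn X univ _ (Topology.scott X univ) U
    (@Topology.IsScott.mk X univ _ (Topology.scott X univ) rfl), dirSupInaccOn_univ]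

theorem IsContinuousPoset.isOpen_scott_setOf_wayBelow (h : IsContinuousPoset X) (u : X) :
    IsOpen[Topology.scott X univ] {x | WayBelow u x} := by
  refine isOpen_scott_iff.2 ⟨isUpperSet_setOf_wayBelow u, fun D hn hd s hs hus => ?_⟩
  obtain ⟨v, huv, hvs⟩ := h.interpolate hus
  obtain ⟨d, hd1, hvd⟩ := hvs D hn hd s hs le_rfl
  exact ⟨d, hd1, huv.trans_le hvd⟩

theorem IsContinuousPoset.exists_wayBelow_mem (h : IsContinuousPoset X) {U : Set X}
    (hU : IsOpen[Topology.scott X univ] U) {x : X} (hx : x ∈ U) : ∃ u ∈ U, WayBelow u x := by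
  obtain ⟨hn, hd, hs⟩ := h.wayBelow_approx x
  obtain ⟨u, hu, huU⟩ := (isOpen_scott_iff.1 hU).2 hn hd hs hx
  exact ⟨u, huU, hu⟩

theorem IsContinuousPoset.exists_wayBelow_not_le (h : IsContinuousPoset X) {x y : X}
    (hxy : ¬ x ≤ y) : ∃ u, WayBelow u x ∧ ¬ u ≤ y := by
  by_contra! hc
  exact hxy ((h.wayBelow_approx x).2.2.2 hc)

theorem IsContinuousDomain.isMeetContinuousDomain (h : IsContinuousDomain X) :
    IsMeetContinuousDomain X := by
  refine ⟨h.1, fun x D hn hd s hs hxs => ?_⟩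
  rw [@mem_closure_iff X (Topology.scott X univ)]
  intro U hU hxU
  obtain ⟨u, hu, hux⟩ := h.2.exists_wayBelow_mem hU hxU
  obtain ⟨d, hd1, hud⟩ := hux D hn hd s hs hxs
  exact ⟨u, hu, ⟨d, hd1, hud⟩, hux.le⟩

theorem IsMeetContinuousDomain.exists_mem_le_le (h : IsMeetContinuousDomain X) {U D : Set X}
    (hU : IsOpen[Topology.scott X univ] U) (hn : D.Nonempty) (hd : DirectedOn (· ≤ ·) D) {s x : X}
    (hs : IsLUB D s) (hxs : x ≤ s) (hx : x ∈ U) : ∃ z ∈ U, z ≤ x ∧ ∃ d ∈ D, z ≤ d := by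
  obtain ⟨z, hz, ⟨d, hd1, hzd⟩, hzx⟩ :=
    (@mem_closure_iff X (Topology.scott X univ) _ _).1 (h.2 x D hn hd s hs hxs) U hU hx
  exact ⟨z, hz, hzx, d, hd1, hzd⟩

/-- If `w ∈ U ∩ ↓x` is below `⋁ D`, then `w` is in the Scott closure of `↓D ∩ ↓w`, so `U` meets that
set. -/
theorem IsMeetContinuousDomain.isOpen_scott_upperClosure_inter_Iic (h : IsMeetContinuousDomain X)
    {U : Set X} (hU : IsOpen[Topology.scott X univ] U) (x : X) :
    IsOpen[Topology.scott X univ] (upperClosure (U ∩ Iic x) : Set X) := by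
  refine isOpen_scott_iff.2 ⟨(upperClosure _).upper, ?_⟩
  rintro D hn hd s hs ⟨w, ⟨hw, hwx⟩, hws⟩
  obtain ⟨z, hz, hzw, d, hd1, hzd⟩ := h.exists_mem_le_le hU hn hd hs hws hw
  exact ⟨d, hd1, z, ⟨hz, hzw.trans hwx⟩, hzd⟩

/-- In a meet-continuous domain, a Scott-open set covered by finitely many principal filters is
covered by their Scott interiors. -/
theorem IsMeetContinuousDomain.exists_isOpen_scott_subset_Ici (h : IsMeetContinuousDomain X)
    {U F : Set X} (hF : F.Finite) (hU : IsOpen[Topology.scott X univ] U)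
    (hUF : U ⊆ (upperClosure F : Set X)) {x : X} (hx : x ∈ U) :
    ∃ f ∈ F, ∃ V, IsOpen[Topology.scott X univ] V ∧ x ∈ V ∧ V ⊆ Ici f := by
  by_contra! hc
  -- Descend inside `U ∩ ↓x`, escaping one core at a time: `↑(U ∩ ↓w)` is a Scott-open set around
  -- `x`, so it is not inside `↑g`. Going down never re-enters a core already left. At `G = F` this
  -- contradicts `U ⊆ ↑F`.
  have key : ∀ G : Set X, G.Finite → G ⊆ F → ∃ w ∈ U, w ≤ x ∧ ∀ g ∈ G, ¬ g ≤ w := by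
    intro G hG
    induction G, hG using Set.Finite.induction_on with
    | empty => exact fun _ => ⟨x, hx, le_rfl, by simp⟩
    | @insert g G _ _ ih =>
      intro hGF
      obtain ⟨w, hwU, hwx, hw⟩ := ih ((subset_insert _ _).trans hGF)
      have hV := h.isOpen_scott_upperClosure_inter_Iic hU w
      have := hc g (hGF (mem_insert _ _)) _ hV ⟨w, ⟨hwU, le_rfl⟩, hwx⟩
      obtain ⟨y, ⟨z, ⟨hzU, hzw⟩, hzy⟩, hy⟩ := not_subset.1 this
      refine ⟨z, hzU, hzw.trans hwx, ?_⟩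
      rintro k (rfl | hk) hkz
      · exact hy (hkz.trans hzy)
      · exact hw k hk (hkz.trans hzw)
  obtain ⟨w, hwU, -, hw⟩ := key F hF subset_rfl
  obtain ⟨f, hf, hfw⟩ := hUF hwU
  exact hw f hf hfw

theorem isUpperSet_of_mem_latticeOfCores {Y : Set X} (hY : Y ∈ latticeOfCores X) :
    IsUpperSet Y := by
  refine latticeClosure_min (t := {Y : Set X | IsUpperSet Y}) ?_ ?_ hY
  · rintro Y (rfl | rfl | ⟨a, rfl⟩)
    exacts [isUpperSet_empty, isUpperSet_univ, isUpperSet_Ici a]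
  · exact ⟨fun a ha b hb => ha.union hb, fun a ha b hb => ha.inter hb⟩

theorem isUpperSet_of_mem_finiteMeetsOfCores {Y : Set X} (hY : Y ∈ finiteMeetsOfCores X) :
    IsUpperSet Y := by
  obtain ⟨F, -, rfl⟩ := hY
  exact isUpperSet_iInter₂ fun a _ => isUpperSet_Ici a

theorem univ_mem_finiteMeetsOfCores : univ ∈ finiteMeetsOfCores X :=
  ⟨∅, finite_empty, by simp⟩

theorem Ici_inter_Ici_mem_finiteMeetsOfCores (a b : X) :
    Ici a ∩ Ici b ∈ finiteMeetsOfCores X :=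
  ⟨{a, b}, by simp, by simp⟩

theorem univ_mem_latticeOfCores : univ ∈ latticeOfCores X :=
  subset_latticeClosure (by simp)

theorem Ici_mem_latticeOfCores (a : X) : Ici a ∈ latticeOfCores X :=
  subset_latticeClosure (by simp)

theorem Ici_inter_Ici_mem_latticeOfCores (a b : X) : Ici a ∩ Ici b ∈ latticeOfCores X :=
  isSublattice_latticeClosure.infClosed (Ici_mem_latticeOfCores a) (Ici_mem_latticeOfCores b)

theorem upperClosure_mem_latticeOfCores {F : Set X} (hF : F.Finite) :
    (upperClosure F : Set X) ∈ latticeOfCores X := by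
  induction F, hF using Set.Finite.induction_on with
  | empty => exact subset_latticeClosure (by simp)
  | @insert a F _ _ ih =>
    have : (upperClosure (insert a F) : Set X) = Ici a ∪ upperClosure F := by
      ext y; simp [mem_upperClosure]
    rw [this]
    exact isSublattice_latticeClosure.supClosed (Ici_mem_latticeOfCores a) ih

end Order

/-! ### Directed sets are irreducible, so sober spaces are d-spaces. -/

section Space

variable {X : Type*} [TopologicalSpace X]

theorem isIrreducible_of_directedOn {D : Set X} (hn : D.Nonempty)
    (hd : DirectedOn (fun x y => x ∈ closure {y}) D) : IsIrreducible D := by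
  refine ⟨hn, ?_⟩
  rintro U V hU hV ⟨a, ha, haU⟩ ⟨b, hb, hbV⟩
  obtain ⟨c, hc, hac, hbc⟩ := hd a ha b hb
  refine ⟨c, hc, ?_, ?_⟩
  · obtain ⟨_, h, rfl⟩ := mem_closure_iff.1 hac U hU haU
    exact h
  · obtain ⟨_, h, rfl⟩ := mem_closure_iff.1 hbc V hV hbV
    exact h

theorem IsSober.isDSpace (h : IsSober X) : IsDSpace X := by
  refine ⟨h.1, fun D hn hd => ?_⟩
  obtain ⟨x, hx⟩ := h.2.sober (isIrreducible_of_directedOn hn hd).closure isClosed_closure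
  exact ⟨x, hx.symm⟩

end Space

/-! ### Upper interiors, separation and stability in ordered spaces. -/

section OrderedSpace

variable {X : Type*} [PartialOrder X] [TopologicalSpace X]

theorem mem_interior_upperTopology {Y : Set X} {x : X} :
    x ∈ @interior X (upperTopology X) Y ↔
      ∃ U : Set X, IsOpen U ∧ IsUpperSet U ∧ x ∈ U ∧ U ⊆ Y := by
  rw [@mem_interior X (upperTopology X)]
  exact ⟨fun ⟨U, hUY, ⟨hU, hU'⟩, hx⟩ => ⟨U, hU, hU', hx, hUY⟩,
    fun ⟨U, hU, hU', hx, hUY⟩ => ⟨U, hUY, ⟨hU, hU'⟩, hx⟩⟩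

theorem isStableFor_iff_of_isUpperSet {Z : Set (Set X)} (hZ : ∀ Y ∈ Z, IsUpperSet Y) :
    IsStableFor X Z ↔ ∀ Y ∈ Z, ∀ x ∈ @interior X (upperTopology X) Y,
      ∃ y ∈ Y, x ∈ @interior X (upperTopology X) (Ici y) := by
  refine forall₂_congr fun Y hY => ?_
  constructor
  · intro h x hx
    rw [h] at hx
    simpa using hx
  · refine fun h => Subset.antisymm (fun x hx => by simpa using h x hx) ?_
    exact iUnion₂_subset fun y hy =>
      @interior_mono X (upperTopology X) _ _ ((hZ Y hY).Ici_subset hy)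

theorem isMeetStable_iff : IsMeetStable X ↔ ∀ Y ∈ finiteMeetsOfCores X,
    ∀ x ∈ @interior X (upperTopology X) Y, ∃ y ∈ Y, x ∈ @interior X (upperTopology X) (Ici y) :=
  isStableFor_iff_of_isUpperSet fun _ => isUpperSet_of_mem_finiteMeetsOfCores

theorem isDiamondStable_iff : IsDiamondStable X ↔ ∀ Y ∈ latticeOfCores X,
    ∀ x ∈ @interior X (upperTopology X) Y, ∃ y ∈ Y, x ∈ @interior X (upperTopology X) (Ici y) :=
  isStableFor_iff_of_isUpperSet fun _ => isUpperSet_of_mem_latticeOfCores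

theorem IsHyperconvex.isOpen_diff (h : IsHyperconvex X) {U F : Set X} (hU : IsOpen U)
    (hU' : IsUpperSet U) (hF : F.Finite) : IsOpen (U \ (upperClosure F : Set X)) :=
  h.isOpen ⟨U, F, hU, hU', hF, rfl⟩

theorem IsHyperconvex.exists_diff_subset (h : IsHyperconvex X) {O : Set X} {x : X}
    (hO : IsOpen O) (hx : x ∈ O) : ∃ U F : Set X, IsOpen U ∧ IsUpperSet U ∧ F.Finite ∧
      x ∈ U ∧ x ∉ upperClosure F ∧ U \ (upperClosure F : Set X) ⊆ O := by
  obtain ⟨_, ⟨U, F, hU, hU', hF, rfl⟩, ⟨hxU, hxF⟩, hs⟩ := h.exists_subset_of_mem_open hx hO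
  exact ⟨U, F, hU, hU', hF, hxU, hxF, hs⟩

theorem IsHyperconvex.isClosed_upperClosure (h : IsHyperconvex X) {F : Set X} (hF : F.Finite) :
    IsClosed (upperClosure F : Set X) := by
  have := h.isOpen_diff isOpen_univ isUpperSet_univ hF
  rwa [← compl_eq_univ_sdiff, isOpen_compl_iff] at this

theorem IsHyperconvex.isClosed_Ici (h : IsHyperconvex X) (x : X) : IsClosed (Ici x) := by
  simpa using h.isClosed_upperClosure (finite_singleton x)

theorem IsSemiPospace.isClosed_upperClosure (h : IsSemiPospace X) {F : Set X} (hF : F.Finite) :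
    IsClosed (upperClosure F : Set X) := by
  rw [coe_upperClosure]
  exact hF.isClosed_biUnion fun a _ => h.2 a

theorem IsPospace.isSemiPospace (h : IsPospace X) : IsSemiPospace X :=
  ⟨fun x => h.preimage (f := fun y => (y, x)) (by fun_prop),
    fun x => h.preimage (f := fun y => (x, y)) (by fun_prop)⟩

theorem IsT2Ordered.isPospace (h : IsT2Ordered X) : IsPospace X := by
  rw [IsPospace, ← isOpen_compl_iff, isOpen_iff_mem_nhds]
  rintro ⟨x, y⟩ hxy
  obtain ⟨U, V, hU, hU', hV, -, hx, hy, hd⟩ := h x y hxy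
  filter_upwards [prod_mem_nhds (hU.mem_nhds hx) (hV.mem_nhds hy)]
  rintro ⟨a, b⟩ ⟨ha, hb⟩ hab
  exact disjoint_left.1 hd (hU' hab ha) hb

theorem IsT2Ordered.t2Space (h : IsT2Ordered X) : T2Space X := by
  refine ⟨fun x y hxy => ?_⟩
  by_cases hle : x ≤ y
  · obtain ⟨U, V, hU, -, hV, -, hy, hx, hd⟩ := h y x fun hyx => hxy (le_antisymm hle hyx)
    exact ⟨V, U, hV, hU, hx, hy, hd.symm⟩
  · obtain ⟨U, V, hU, -, hV, -, hx, hy, hd⟩ := h x y hle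
    exact ⟨U, V, hU, hV, hx, hy, hd⟩

theorem IsUpperT3Ordered.isT2Ordered (h : IsUpperT3Ordered X) : IsT2Ordered X := by
  intro x y hxy
  obtain ⟨U, B, hU, hU', hB, hB', hx, hUB, hBy⟩ :=
    h.1 (Iic y)ᶜ x (h.2.1 y).isOpen_compl (isLowerSet_Iic y).compl hxy
  exact ⟨U, Bᶜ, hU, hU', hB.isOpen_compl, hB'.compl, hx, fun hy => hBy hy le_rfl,
    disjoint_compl_right_iff_subset.2 hUB⟩

theorem IsMcOrdered.isDomain (h : IsMcOrdered X) : IsDomain X := fun D hn hd =>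
  (h D hn hd).imp fun _ hs => hs.1

theorem IsMcOrdered.dirSupInacc (h : IsMcOrdered X) {U : Set X} (hU : IsOpen U) :
    DirSupInacc U := by
  intro D hn hd s hs hsU
  obtain ⟨t, ht, hlim⟩ := h D hn hd
  obtain rfl := hs.unique ht
  have : Nonempty D := hn.to_subtype
  have : IsDirectedOrder D := ⟨hd.directed_val⟩
  obtain ⟨d, hdU⟩ := (hlim.eventually (hU.mem_nhds hsU)).exists
  exact ⟨d, d.2, hdU⟩

theorem IsCoreStable.isUpStable (h : IsCoreStable X) : IsUpStable X := fun O hO => by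
  rw [h O hO]
  exact isOpen_biUnion fun _ _ => isOpen_interior

/-- By `↑`-stability the up-closure of `interior (Ici u)` is an open upper set, still inside `↑u`;
so passing to the upper topology loses no interior points of a core. -/
theorem IsCoreStable.exists_mem_interior (h : IsCoreStable X) {O : Set X} (hO : IsOpen O) {x : X}
    (hx : x ∈ O) : ∃ u ∈ O, x ∈ @interior X (upperTopology X) (Ici u) := by
  have hx' : x ∈ (upperClosure O : Set X) := subset_upperClosure hx
  rw [h O hO] at hx'
  obtain ⟨u, hu, hxu⟩ := mem_iUnion₂.1 hx'
  exact ⟨u, hu, mem_interior_upperTopology.2 ⟨_, h.isUpStable _ isOpen_interior,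
    (upperClosure _).upper, subset_upperClosure hxu,
    upperClosure_min interior_subset (isUpperSet_Ici u)⟩⟩

theorem IsFanSpace.exists_mem_interior (h : IsFanSpace X) {O : Set X} (hO : IsOpen O) {x : X}
    (hx : x ∈ O) : ∃ u ∈ O, x ∈ @interior X (upperTopology X) (Ici u) := by
  obtain ⟨u, F, -, hn, hs⟩ := h.2.2 x O (hO.mem_nhds hx)
  have hxu := mem_of_mem_nhds hn
  -- A nonempty fan contains its apex: `u ∈ ↑F` would force `x ∈ ↑F`.
  refine ⟨u, hs ⟨le_rfl, fun huF => hxu.2 ((upperClosure F).upper hxu.1 huF)⟩,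
    mem_interior_upperTopology.2 ⟨_, h.1 _ isOpen_interior, (upperClosure _).upper,
    subset_upperClosure (mem_interior_iff_mem_nhds.2 hn),
    upperClosure_min (interior_subset.trans sdiff_subset) (isUpperSet_Ici u)⟩⟩

theorem IsFanSpace.isHyperconvex (h : IsFanSpace X) : IsHyperconvex X := by
  refine TopologicalSpace.isTopologicalBasis_of_isOpen_of_nhds ?_ ?_
  · rintro _ ⟨U, F, hU, -, hF, rfl⟩
    exact hU.sdiff (h.2.1.isClosed_upperClosure hF)
  · intro x O hx hO
    obtain ⟨u, F, hF, hn, hs⟩ := h.2.2 x O (hO.mem_nhds hx)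
    refine ⟨_, ⟨upperClosure (interior (Ici u \ (upperClosure F : Set X))), F,
      h.1 _ isOpen_interior, (upperClosure _).upper, hF, rfl⟩,
      ⟨subset_upperClosure (mem_interior_iff_mem_nhds.2 hn), (mem_of_mem_nhds hn).2⟩, ?_⟩
    exact Subset.trans (sdiff_subset_sdiff_left
      (upperClosure_min (interior_subset.trans sdiff_subset) (isUpperSet_Ici u))) hs

/-! ### Recognizing Lawson spaces of continuous domains. -/

theorem isLawson_of_isHyperconvex (h : IsHyperconvex X)
    (hs : ∀ U : Set X, (IsOpen U ∧ IsUpperSet U) ↔ IsOpen[Topology.scott X univ] U) :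
    Topology.IsLawson X := by
  refine ⟨?_⟩
  have hl := @Topology.IsLawson.isTopologicalBasis X _ (Topology.lawson X)
    (@Topology.IsLawson.mk X _ (Topology.lawson X) rfl)
  have heq : {B : Set X | ∃ U F : Set X, IsOpen U ∧ IsUpperSet U ∧ F.Finite ∧
      B = U \ (upperClosure F : Set X)} = Topology.IsLawson.lawsonBasis X := by
    ext B
    constructor
    · rintro ⟨U, F, hU, hU', hF, rfl⟩
      exact ⟨F, hF, U, (hs U).1 ⟨hU, hU'⟩, rfl⟩
    · rintro ⟨F, hF, U, hU, rfl⟩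
      exact ⟨U, F, ((hs U).2 hU).1, ((hs U).2 hU).2, hF, rfl⟩
  rw [IsHyperconvex, heq] at h
  rw [h.eq_generateFrom,
    @TopologicalSpace.IsTopologicalBasis.eq_generateFrom X (Topology.lawson X) _ hl]

theorem isLawsonSpaceOfContinuousDomain_of_exists_mem_interior (hX : IsHyperconvex X)
    (hdom : IsDomain X) (hIic : ∀ x : X, IsClosed (Iic x))
    (hsc : ∀ U : Set X, IsOpen U → IsUpperSet U → DirSupInacc U)
    (hcore : ∀ (O : Set X) (x : X), IsOpen O → x ∈ O →
      ∃ u ∈ O, x ∈ @interior X (upperTopology X) (Ici u)) :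
    IsLawsonSpaceOfContinuousDomain X := by
  let A : X → Set X := fun x => {u | x ∈ @interior X (upperTopology X) (Ici u)}
  have hne : ∀ x, (A x).Nonempty := fun x => by
    obtain ⟨u, -, hu⟩ := hcore univ x isOpen_univ (mem_univ x)
    exact ⟨u, hu⟩
  have hdir : ∀ x, DirectedOn (· ≤ ·) (A x) := by
    intro x u hu v hv
    obtain ⟨U, hU, -, hxU, hUu⟩ := mem_interior_upperTopology.1 hu
    obtain ⟨V, hV, -, hxV, hVv⟩ := mem_interior_upperTopology.1 hv
    obtain ⟨w, hw, hxw⟩ := hcore (U ∩ V) x (hU.inter hV) ⟨hxU, hxV⟩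
    exact ⟨w, hxw, hUu hw.1, hVv hw.2⟩
  have hlub : ∀ x, IsLUB (A x) x := by
    refine fun x => ⟨fun u hu => @interior_subset X (upperTopology X) _ _ hu, fun b hb => ?_⟩
    by_contra hxb
    -- An upper bound `b` of `A x` not above `x` would leave a member of `A x` in the open set `X \
    -- ↓b`.
    obtain ⟨u, hu, hxu⟩ := hcore (Iic b)ᶜ x (hIic b).isOpen_compl hxb
    exact hu (hb hxu)
  refine ⟨⟨hdom, isContinuousPoset_of_wayBelow_approx fun x =>
    ⟨A x, hne x, hdir x, hlub x, fun u hu D hn hd s hs hxs => ?_⟩⟩,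
    isLawson_of_isHyperconvex hX fun U =>
      ⟨fun h => isOpen_scott_iff.2 ⟨h.2, hsc U h.1 h.2⟩, fun h => ?_⟩⟩
  · obtain ⟨U, hU, hU', hxU, hUu⟩ := mem_interior_upperTopology.1 hu
    obtain ⟨d, hdD, hdU⟩ := hsc U hU hU' hn hd hs (hU' hxs hxU)
    exact ⟨d, hdD, hUu hdU⟩
  · obtain ⟨hU', hU⟩ := isOpen_scott_iff.1 h
    refine ⟨isOpen_iff_mem_nhds.2 fun x hx => ?_, hU'⟩
    obtain ⟨u, hu, huU⟩ := hU (hne x) (hdir x) (hlub x) hx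
    obtain ⟨V, hV, -, hxV, hVu⟩ := mem_interior_upperTopology.1 hu
    exact mem_of_superset (hV.mem_nhds hxV) (hVu.trans (hU'.Ici_subset huU))

theorem isLawsonSpaceOfContinuousDomain_of_t2Space [T2Space X] (hX : IsHyperconvex X)
    (hmc : IsMcOrdered X) (hne : ∀ x : X, ∃ u, x ∈ @interior X (upperTopology X) (Ici u))
    (hdir : ∀ u v x : X, x ∈ @interior X (upperTopology X) (Ici u ∩ Ici v) →
      ∃ w ∈ Ici u ∩ Ici v, x ∈ @interior X (upperTopology X) (Ici w))
    (hfin : ∀ F : Set X, F.Finite → ∀ x ∈ @interior X (upperTopology X) (upperClosure F : Set X),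
      ∃ y ∈ (upperClosure F : Set X), x ∈ @interior X (upperTopology X) (Ici y)) :
    IsLawsonSpaceOfContinuousDomain X := by
  have key : ∀ x : X, {u | x ∈ @interior X (upperTopology X) (Ici u)}.Nonempty ∧
      DirectedOn (· ≤ ·) {u | x ∈ @interior X (upperTopology X) (Ici u)} ∧
      IsLUB {u | x ∈ @interior X (upperTopology X) (Ici u)} x := by
    intro x
    have hdx : DirectedOn (· ≤ ·) {u | x ∈ @interior X (upperTopology X) (Ici u)} := by
      intro u hu v hv
      obtain ⟨w, hw, hxw⟩ := hdir u v x
        (by rw [@interior_inter X (upperTopology X)]; exact ⟨hu, hv⟩)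
      exact ⟨w, hxw, hw⟩
    refine ⟨hne x, hdx, ?_⟩
    obtain ⟨s, hs, -⟩ := hmc _ (hne x) hdx
    have hsx : s ≤ x := hs.2 fun u hu => @interior_subset X (upperTopology X) _ _ hu
    -- It remains to exclude `s < x`, which is where T₂ enters.
    suffices x = s by rwa [← this] at hs
    by_contra hxs
    obtain ⟨O, O', hO, hO', hxO, hsO', hd⟩ := t2_separation hxs
    obtain ⟨U, F, hU, hU', hF, hxU, hxF, hUO⟩ := hX.exists_diff_subset hO hxO
    obtain ⟨V, G, hV, hV', hG, hsV, hsG, hVO⟩ := hX.exists_diff_subset hO' hsO'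
    -- As `s ≤ x`, the open upper set `U ∩ V` contains `x`; disjointness puts it inside `↑(F ∪ G)`.
    -- The resulting `y ∈ A x` lies below both `s` and `x`, yet above a point of `F` or `G`.
    obtain ⟨y, ⟨f, hf, hfy⟩, hxy⟩ := hfin (F ∪ G) (hF.union hG) x
      (mem_interior_upperTopology.2 ⟨U ∩ V, hU.inter hV, hU'.inter hV', ⟨hxU, hV' hsx hsV⟩, by
        rintro z ⟨hzU, hzV⟩
        rw [upperClosure_union]
        by_contra hz
        refine disjoint_left.1 hd (hUO ⟨hzU, fun h => hz (Or.inl h)⟩)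
          (hVO ⟨hzV, fun h => hz (Or.inr h)⟩)⟩)
    have hys : y ≤ s := hs.1 hxy
    rcases hf with hf | hf
    · exact hxF ⟨f, hf, hfy.trans (hys.trans hsx)⟩
    · exact hsG ⟨f, hf, hfy.trans hys⟩
  refine isLawsonSpaceOfContinuousDomain_of_exists_mem_interior hX hmc.isDomain (fun x => ?_)
    (fun U hU _ => hmc.dirSupInacc hU) (fun O x hO hx => ?_)
  · rw [← isOpen_compl_iff, isOpen_iff_mem_nhds]
    intro y hyx
    obtain ⟨u, hu, hux⟩ : ∃ u, y ∈ @interior X (upperTopology X) (Ici u) ∧ ¬ u ≤ x := by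
      by_contra! hc
      exact hyx ((key y).2.2.2 hc)
    obtain ⟨V, hV, -, hyV, hVu⟩ := mem_interior_upperTopology.1 hu
    exact mem_of_superset (hV.mem_nhds hyV) fun z hz hzx => hux ((hVu hz).trans hzx)
  · obtain ⟨U, F, hU, hU', hF, hxU, hxF, hUO⟩ := hX.exists_diff_subset hO hx
    obtain ⟨hn, hd, hs⟩ := key x
    obtain ⟨u, hu, huU⟩ := hmc.dirSupInacc hU hn hd hs hxU
    exact ⟨u, hUO ⟨huU, fun h => hxF ((upperClosure F).upper (hs.1 hu) h)⟩, hu⟩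

/-! ### From Lawson topologies and stability to continuity. -/

theorem isOpen_iff_isOpen_scott_of_isUpperSet [Topology.IsLawson X] {U : Set X}
    (hU : IsUpperSet U) : IsOpen U ↔ IsOpen[Topology.scott X univ] U :=
  @Topology.lawsonOpen_iff_scottOpen_of_isUpperSet' X _ ‹_› (Topology.scott X univ) _
    (@Topology.IsScott.mk X univ _ (Topology.scott X univ) rfl) U hU

theorem isOpen_of_isOpen_scott [Topology.IsLawson X] {U : Set X}
    (hU : IsOpen[Topology.scott X univ] U) : IsOpen U :=
  (isOpen_iff_isOpen_scott_of_isUpperSet (isOpen_scott_iff.1 hU).1).2 hU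

theorem isHyperconvex_of_isLawson [Topology.IsLawson X] : IsHyperconvex X := by
  have hl := Topology.IsLawson.isTopologicalBasis X
  suffices {B : Set X | ∃ U F : Set X, IsOpen U ∧ IsUpperSet U ∧ F.Finite ∧
      B = U \ (upperClosure F : Set X)} = Topology.IsLawson.lawsonBasis X by
    rwa [IsHyperconvex, this]
  ext B
  constructor
  · rintro ⟨U, F, hU, hU', hF, rfl⟩
    exact ⟨F, hF, U, (isOpen_iff_isOpen_scott_of_isUpperSet hU').1 hU, rfl⟩
  · rintro ⟨F, hF, U, hU, rfl⟩
    exact ⟨U, F, isOpen_of_isOpen_scott hU, (isOpen_scott_iff.1 hU).1, hF, rfl⟩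

/-- For a basic neighborhood `U \ ↑F` of the join, a tail of `D` lies in the Scott-open `U`, and all
of `D` avoids `↑F` because its join does. -/
theorem IsDomain.isMcOrdered [Topology.IsLawson X] (h : IsDomain X) : IsMcOrdered X := by
  intro D hn hd
  obtain ⟨s, hs⟩ := h D hn hd
  refine ⟨s, hs, fun O hO => ?_⟩
  obtain ⟨O', hO', hO'o, hsO'⟩ := mem_nhds_iff.1 hO
  obtain ⟨U, F, hU, hU', hF, hsU, hsF, hUO⟩ :=
    isHyperconvex_of_isLawson.exists_diff_subset hO'o hsO'
  obtain ⟨d, hdD, hdU⟩ := (isOpen_scott_iff.1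
    ((isOpen_iff_isOpen_scott_of_isUpperSet hU').1 hU)).2 hn hd hs hsU
  have : Nonempty D := hn.to_subtype
  refine (eventually_ge_atTop (⟨d, hdD⟩ : D)).mono fun (e : D) he => ?_
  exact hO' (hUO ⟨hU' he hdU, fun h => hsF ((upperClosure F).upper (hs.1 e.2) h)⟩)

theorem IsLawsonSpaceOfMeetContinuousDomain.isLawsonSpaceOfContinuousDomain [T2Space X]
    (h : IsLawsonSpaceOfMeetContinuousDomain X) (hst : IsMeetStable X) :
    IsLawsonSpaceOfContinuousDomain X := by
  have := h.2
  rw [isMeetStable_iff] at hst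
  refine isLawsonSpaceOfContinuousDomain_of_t2Space isHyperconvex_of_isLawson h.1.1.isMcOrdered
    (fun x => ?_) (fun u v => hst _ (Ici_inter_Ici_mem_finiteMeetsOfCores u v))
    (fun F hF x hx => ?_)
  · obtain ⟨u, -, hu⟩ := hst univ univ_mem_finiteMeetsOfCores x
      (by rw [@interior_univ X (upperTopology X)]; exact mem_univ x)
    exact ⟨u, hu⟩
  · obtain ⟨U, hU, hU', hxU, hUF⟩ := mem_interior_upperTopology.1 hx
    obtain ⟨f, hf, V, hV, hxV, hVf⟩ := h.1.exists_isOpen_scott_subset_Ici hF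
      ((isOpen_iff_isOpen_scott_of_isUpperSet hU').1 hU) hUF hxU
    exact ⟨f, subset_upperClosure hf, mem_interior_upperTopology.2
      ⟨V, isOpen_of_isOpen_scott hV, (isOpen_scott_iff.1 hV).1, hxV, hVf⟩⟩

theorem IsDiamondStable.isLawsonSpaceOfContinuousDomain [T2Space X] (hst : IsDiamondStable X)
    (hX : IsHyperconvex X) (hmc : IsMcOrdered X) : IsLawsonSpaceOfContinuousDomain X := by
  rw [isDiamondStable_iff] at hst
  refine isLawsonSpaceOfContinuousDomain_of_t2Space hX hmc
    (fun x => ?_) (fun u v => hst _ (Ici_inter_Ici_mem_latticeOfCores u v))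
    (fun F hF => hst _ (upperClosure_mem_latticeOfCores hF))
  obtain ⟨u, -, hu⟩ := hst univ univ_mem_latticeOfCores x
    (by rw [@interior_univ X (upperTopology X)]; exact mem_univ x)
  exact ⟨u, hu⟩

theorem IsCoreStable.isLawsonSpaceOfContinuousDomain (h : IsCoreStable X)
    (hX : IsHyperconvex X) (hmc : IsMcOrdered X) (hs : IsSemiPospace X) :
    IsLawsonSpaceOfContinuousDomain X :=
  isLawsonSpaceOfContinuousDomain_of_exists_mem_interior hX hmc.isDomain hs.1
    (fun _ hU _ => hmc.dirSupInacc hU) fun _ _ hO hx => h.exists_mem_interior hO hx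

/-! ### Closures in the upper space, and fan spaces. -/

theorem mem_closure_upperTopology {A : Set X} {x : X} :
    x ∈ @closure X (upperTopology X) A ↔
      ∀ U : Set X, IsOpen U → IsUpperSet U → x ∈ U → ∃ a ∈ A, a ∈ U := by
  rw [@mem_closure_iff X (upperTopology X)]
  exact ⟨fun h U hU hU' hx => (h U ⟨hU, hU'⟩ hx).imp fun _ ha => ⟨ha.2, ha.1⟩,
    fun h U hU hx => (h U hU.1 hU.2 hx).imp fun _ ha => ⟨ha.2, ha.1⟩⟩

theorem closure_upperTopology_singleton {y : X} (hy : IsClosed (Iic y)) :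
    @closure X (upperTopology X) {y} = Iic y := by
  ext x
  rw [mem_closure_upperTopology]
  constructor
  · intro h
    by_contra hxy
    obtain ⟨_, rfl, ha⟩ := h (Iic y)ᶜ hy.isOpen_compl (isLowerSet_Iic y).compl hxy
    exact ha le_rfl
  · exact fun hxy U _ hU hx => ⟨y, rfl, hU hxy hx⟩

theorem IsFanSpace.isLawsonSpaceOfContinuousDomain (h : IsFanSpace X)
    (hd : IsDSpace (UpperSpace X)) : IsLawsonSpaceOfContinuousDomain X := by
  have hd' : ∀ D : Set X, D.Nonempty →
      DirectedOn (fun x y => x ∈ @closure X (upperTopology X) {y}) D →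
      ∃ x, @closure X (upperTopology X) D = @closure X (upperTopology X) {x} := hd.2
  simp only [closure_upperTopology_singleton (h.2.1.1 _), mem_Iic] at hd'
  have key : ∀ D : Set X, D.Nonempty → DirectedOn (· ≤ ·) D →
      ∃ s, IsLUB D s ∧ s ∈ @closure X (upperTopology X) D := by
    intro D hn hD
    obtain ⟨s, hs⟩ := hd' D hn hD
    -- The closure of `D` is `↓s`. This makes `s` the join, and `s ∈ closure D` is the
    -- inaccessibility of open upper sets.
    have hsD : s ∈ @closure X (upperTopology X) D := hs ▸ self_mem_Iic
    refine ⟨s, ⟨fun d hdD => ?_, fun b hb => ?_⟩, hsD⟩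
    · rw [← mem_Iic, ← hs]
      exact @subset_closure X (upperTopology X) _ _ hdD
    · by_contra hsb
      obtain ⟨d, hdD, hdb⟩ := mem_closure_upperTopology.1 hsD (Iic b)ᶜ
        (h.2.1.1 b).isOpen_compl (isLowerSet_Iic b).compl hsb
      exact hdb (hb hdD)
  refine isLawsonSpaceOfContinuousDomain_of_exists_mem_interior h.isHyperconvex
    (fun D hn hD => (key D hn hD).imp fun _ hs => hs.1) h.2.1.1 (fun U hU hU' D hn hD s hs hsU => ?_)
    fun _ _ hO hx => h.exists_mem_interior hO hx
  obtain ⟨t, ht, htD⟩ := key D hn hD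
  obtain rfl := hs.unique ht
  exact mem_closure_upperTopology.1 htD U hU hU' hsU

/-! ### Properties of the Lawson space of a continuous domain. -/

namespace IsLawsonSpaceOfContinuousDomain

theorem isHyperconvex (h : IsLawsonSpaceOfContinuousDomain X) : IsHyperconvex X :=
  have := h.2
  isHyperconvex_of_isLawson

theorem isMcOrdered (h : IsLawsonSpaceOfContinuousDomain X) : IsMcOrdered X :=
  have := h.2
  h.1.1.isMcOrdered

theorem isLawsonSpaceOfMeetContinuousDomain (h : IsLawsonSpaceOfContinuousDomain X) :
    IsLawsonSpaceOfMeetContinuousDomain X :=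
  ⟨h.1.isMeetContinuousDomain, h.2⟩

theorem isOpen_setOf_wayBelow (h : IsLawsonSpaceOfContinuousDomain X) (u : X) :
    IsOpen {x | WayBelow u x} :=
  have := h.2
  isOpen_of_isOpen_scott (h.1.2.isOpen_scott_setOf_wayBelow u)

theorem exists_wayBelow_mem_of_isUpperSet (h : IsLawsonSpaceOfContinuousDomain X) {U : Set X}
    (hU : IsOpen U) (hU' : IsUpperSet U) {x : X} (hx : x ∈ U) : ∃ u ∈ U, WayBelow u x :=
  have := h.2
  h.1.2.exists_wayBelow_mem ((isOpen_iff_isOpen_scott_of_isUpperSet hU').1 hU) hx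

theorem mem_interior_of_wayBelow (h : IsLawsonSpaceOfContinuousDomain X) {u x : X}
    (hux : WayBelow u x) : x ∈ @interior X (upperTopology X) (Ici u) :=
  mem_interior_upperTopology.2 ⟨_, h.isOpen_setOf_wayBelow u, isUpperSet_setOf_wayBelow u, hux,
    fun _ hy => hy.le⟩

theorem isT2Ordered (h : IsLawsonSpaceOfContinuousDomain X) : IsT2Ordered X := by
  intro x y hxy
  obtain ⟨u, hux, huy⟩ := h.1.2.exists_wayBelow_not_le hxy
  exact ⟨_, (Ici u)ᶜ, h.isOpen_setOf_wayBelow u, isUpperSet_setOf_wayBelow u,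
    (h.isHyperconvex.isClosed_Ici u).isOpen_compl, (isUpperSet_Ici u).compl, hux, huy,
    disjoint_compl_right_iff_subset.2 fun _ hz => hz.le⟩

theorem isUpperT3Ordered (h : IsLawsonSpaceOfContinuousDomain X) : IsUpperT3Ordered X := by
  refine ⟨fun O x hO hO' hx => ?_, h.isT2Ordered.isPospace.isSemiPospace⟩
  obtain ⟨u, huO, hux⟩ := h.exists_wayBelow_mem_of_isUpperSet hO hO' hx
  exact ⟨_, Ici u, h.isOpen_setOf_wayBelow u, isUpperSet_setOf_wayBelow u,
    h.isHyperconvex.isClosed_Ici u, isUpperSet_Ici u, hux, fun _ hz => hz.le, hO'.Ici_subset huO⟩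

theorem t3Space (h : IsLawsonSpaceOfContinuousDomain X) : T3Space X := by
  have := h.isT2Ordered.t2Space
  have : RegularSpace X := by
    refine RegularSpace.of_exists_mem_nhds_isClosed_subset fun x O hO => ?_
    obtain ⟨O', hO', hO'o, hxO'⟩ := mem_nhds_iff.1 hO
    obtain ⟨U, F, hU, hU', hF, hxU, hxF, hUO⟩ := h.isHyperconvex.exists_diff_subset hO'o hxO'
    obtain ⟨u, huU, hux⟩ := h.exists_wayBelow_mem_of_isUpperSet hU hU' hxU
    -- Lower each `f ∈ F` to some `v f ≪ f` still not below `x`; outside `F` the value is a dummy.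
    have hv : ∀ f, ∃ v, f ∈ F → WayBelow v f ∧ ¬ v ≤ x := fun f => by
      by_cases hf : f ∈ F
      · obtain ⟨v, hv⟩ := h.1.2.exists_wayBelow_not_le fun hfx => hxF ⟨f, hf, hfx⟩
        exact ⟨v, fun _ => hv⟩
      · exact ⟨x, fun hf' => absurd hf' hf⟩
    choose v hv using hv
    -- This closed set is squeezed between the open set `{y | WayBelow u y} \ ↑(v '' F)`, which
    -- contains `x`, and `U \ ↑F`.
    refine ⟨Ici u \ ⋃ f ∈ F, {y | WayBelow (v f) y}, ?_,
      (h.isHyperconvex.isClosed_Ici u).sdiff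
        (isOpen_biUnion fun f _ => h.isOpen_setOf_wayBelow (v f)), ?_⟩
    · refine mem_of_superset ((h.isHyperconvex.isOpen_diff (h.isOpen_setOf_wayBelow u)
        (isUpperSet_setOf_wayBelow u) (hF.image v)).mem_nhds ⟨hux, ?_⟩) fun y hy => ⟨hy.1.le, ?_⟩
      · rintro ⟨_, ⟨f, hf, rfl⟩, hfx⟩
        exact (hv f hf).2 hfx
      · intro hy'
        obtain ⟨f, hf, hfy⟩ := mem_iUnion₂.1 hy'
        exact hy.2 ⟨v f, ⟨f, hf, rfl⟩, hfy.le⟩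
    · rintro y ⟨huy, hy⟩
      refine hO' (hUO ⟨hU' huy huU, ?_⟩)
      rintro ⟨f, hf, hfy⟩
      exact hy (mem_iUnion₂.2 ⟨f, hf, (hv f hf).1.trans_le hfy⟩)
  infer_instance

theorem isCoreStable (h : IsLawsonSpaceOfContinuousDomain X) : IsCoreStable X := by
  intro O hO
  refine Subset.antisymm ?_ (iUnion₂_subset fun u hu => ?_)
  · rintro y ⟨x, hx, hxy⟩
    obtain ⟨U, F, hU, hU', hF, hxU, hxF, hUO⟩ := h.isHyperconvex.exists_diff_subset hO hx
    obtain ⟨u, huU, hux⟩ := h.exists_wayBelow_mem_of_isUpperSet hU hU' hxU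
    exact mem_iUnion₂.2 ⟨u, hUO ⟨huU, fun hu => hxF ((upperClosure F).upper hux.le hu)⟩,
      interior_maximal (fun _ hz => hz.le) (h.isOpen_setOf_wayBelow u) (hux.trans_le hxy)⟩
  · exact interior_subset.trans ((upperClosure O).upper.Ici_subset (subset_upperClosure hu))

theorem isFanSpace (h : IsLawsonSpaceOfContinuousDomain X) : IsFanSpace X := by
  refine ⟨h.isCoreStable.isUpStable, h.isT2Ordered.isPospace.isSemiPospace, fun x O hO => ?_⟩
  obtain ⟨O', hO', hO'o, hxO'⟩ := mem_nhds_iff.1 hO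
  obtain ⟨U, F, hU, hU', hF, hxU, hxF, hUO⟩ := h.isHyperconvex.exists_diff_subset hO'o hxO'
  obtain ⟨u, huU, hux⟩ := h.exists_wayBelow_mem_of_isUpperSet hU hU' hxU
  exact ⟨u, F, hF, mem_of_superset ((h.isHyperconvex.isOpen_diff (h.isOpen_setOf_wayBelow u)
    (isUpperSet_setOf_wayBelow u) hF).mem_nhds ⟨hux, hxF⟩) fun y hy => ⟨hy.1.le, hy.2⟩,
    fun y hy => hO' (hUO ⟨hU' hy.1 huU, hy.2⟩)⟩

theorem isStableFor (h : IsLawsonSpaceOfContinuousDomain X) {Z : Set (Set X)}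
    (hZ : ∀ Y ∈ Z, IsUpperSet Y) : IsStableFor X Z := by
  refine (isStableFor_iff_of_isUpperSet hZ).2 fun Y _ x hx => ?_
  obtain ⟨U, hU, hU', hxU, hUY⟩ := mem_interior_upperTopology.1 hx
  obtain ⟨u, huU, hux⟩ := h.exists_wayBelow_mem_of_isUpperSet hU hU' hxU
  exact ⟨u, hUY huU, h.mem_interior_of_wayBelow hux⟩

theorem isMeetStable (h : IsLawsonSpaceOfContinuousDomain X) : IsMeetStable X :=
  h.isStableFor fun _ => isUpperSet_of_mem_finiteMeetsOfCores

theorem isDiamondStable (h : IsLawsonSpaceOfContinuousDomain X) : IsDiamondStable X :=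
  h.isStableFor fun _ => isUpperSet_of_mem_latticeOfCores

/-- For an irreducible closed `C`, the points way below members of `C` are directed by
irreducibility. Their join `s` lies in `C` since `Cᶜ` is inaccessible, and each `c ∈ C` is below `s`
as the join of its way-below points. -/
theorem isSober_upperSpace (h : IsLawsonSpaceOfContinuousDomain X) : IsSober (UpperSpace X) := by
  have hcl : ∀ y : X, @closure X (upperTopology X) {y} = Iic y := fun y =>
    closure_upperTopology_singleton (h.isT2Ordered.isPospace.isSemiPospace.1 y)
  constructor
  · refine (@t0Space_iff_inseparable X (upperTopology X)).2 fun x y hxy => ?_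
    rw [@inseparable_iff_closure_eq X (upperTopology X), hcl, hcl] at hxy
    exact Iic_injective hxy
  · refine @QuasiSober.mk X (upperTopology X) fun {C} hC hCc => ?_
    have hwb : ∀ c ∈ C, ∀ u, WayBelow u c → (C ∩ {x | WayBelow u x}).Nonempty :=
      fun c hc u hu => ⟨c, hc, hu⟩
    have hopen : ∀ u : X, IsOpen[upperTopology X] {x : X | WayBelow u x} := fun u =>
      ⟨h.isOpen_setOf_wayBelow u, isUpperSet_setOf_wayBelow u⟩
    let D : Set X := {u | ∃ c ∈ C, WayBelow u c}
    have hn : D.Nonempty := by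
      obtain ⟨c, hc⟩ := hC.1
      obtain ⟨u, hu⟩ := (h.1.2.wayBelow_approx c).1
      exact ⟨u, c, hc, hu⟩
    have hd : DirectedOn (· ≤ ·) D := by
      rintro u ⟨c, hc, huc⟩ v ⟨c', hc', hvc'⟩
      obtain ⟨e, he, hue, hve⟩ := hC.2 _ _ (hopen u) (hopen v) (hwb c hc u huc) (hwb c' hc' v hvc')
      obtain ⟨w, hw, huw, hvw⟩ := (h.1.2.wayBelow_approx e).2.1 u hue v hve
      exact ⟨w, ⟨e, he, hw⟩, huw, hvw⟩
    obtain ⟨s, hs⟩ := h.1.1 D hn hd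
    have hCo : IsOpen[upperTopology X] Cᶜ := (@isOpen_compl_iff X C (upperTopology X)).2 hCc
    refine ⟨s, (hcl s).trans (Subset.antisymm ?_ fun c hc => ?_)⟩
    · intro y hys
      by_contra hy
      obtain ⟨u, ⟨c, hc, huc⟩, hu⟩ := h.isMcOrdered.dirSupInacc hCo.1 hn hd hs (hCo.2 hys hy)
      exact hCo.2 huc.le hu hc
    · exact (h.1.2.wayBelow_approx c).2.2.2 fun u hu => hs.1 ⟨c, hc, hu⟩

end IsLawsonSpaceOfContinuousDomain

end OrderedSpace
end OrderedSpace

/-! ### The equivalences. -/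

theorem mainTheorem3 (X : Type*) [PartialOrder X] [TopologicalSpace X] :
    List.TFAE [
      -- (1)
      OrderedSpace.IsLawsonSpaceOfContinuousDomain X,
      -- (2), with a sober upper space, and with a d-space as upper space
      OrderedSpace.IsFanSpace X ∧ OrderedSpace.IsSober (OrderedSpace.UpperSpace X),
      OrderedSpace.IsFanSpace X ∧ OrderedSpace.IsDSpace (OrderedSpace.UpperSpace X),
      -- (3), with each of the four separation axioms
      OrderedSpace.IsLawsonSpaceOfMeetContinuousDomain X ∧ OrderedSpace.IsMeetStable X ∧
        T2Space X,
      OrderedSpace.IsLawsonSpaceOfMeetContinuousDomain X ∧ OrderedSpace.IsMeetStable X ∧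
        OrderedSpace.IsT2Ordered X,
      OrderedSpace.IsLawsonSpaceOfMeetContinuousDomain X ∧ OrderedSpace.IsMeetStable X ∧
        OrderedSpace.IsUpperT3Ordered X,
      OrderedSpace.IsLawsonSpaceOfMeetContinuousDomain X ∧ OrderedSpace.IsMeetStable X ∧
        T3Space X,
      -- (4), for pospaces and for semi-pospaces
      OrderedSpace.IsHyperconvex X ∧ OrderedSpace.IsMcOrdered X ∧
        OrderedSpace.IsCoreStable X ∧ OrderedSpace.IsPospace X,
      OrderedSpace.IsHyperconvex X ∧ OrderedSpace.IsMcOrdered X ∧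
        OrderedSpace.IsCoreStable X ∧ OrderedSpace.IsSemiPospace X,
      -- (5), with each of the four separation axioms
      OrderedSpace.IsHyperconvex X ∧ OrderedSpace.IsMcOrdered X ∧ OrderedSpace.IsUpStable X ∧
        OrderedSpace.IsDiamondStable X ∧ T2Space X,
      OrderedSpace.IsHyperconvex X ∧ OrderedSpace.IsMcOrdered X ∧ OrderedSpace.IsUpStable X ∧
        OrderedSpace.IsDiamondStable X ∧ OrderedSpace.IsT2Ordered X,
      OrderedSpace.IsHyperconvex X ∧ OrderedSpace.IsMcOrdered X ∧ OrderedSpace.IsUpStable X ∧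
        OrderedSpace.IsDiamondStable X ∧ OrderedSpace.IsUpperT3Ordered X,
      OrderedSpace.IsHyperconvex X ∧ OrderedSpace.IsMcOrdered X ∧ OrderedSpace.IsUpStable X ∧
        OrderedSpace.IsDiamondStable X ∧ T3Space X] := by
  tfae_have 1 → 2 := fun h => ⟨h.isFanSpace, h.isSober_upperSpace⟩
  tfae_have 2 → 3 := fun h => ⟨h.1, h.2.isDSpace⟩
  tfae_have 3 → 1 := fun h => h.1.isLawsonSpaceOfContinuousDomain h.2
  tfae_have 1 → 7 := fun h => ⟨h.isLawsonSpaceOfMeetContinuousDomain, h.isMeetStable, h.t3Space⟩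
  tfae_have 7 → 4 := fun ⟨h, hs, _⟩ => ⟨h, hs, inferInstance⟩
  tfae_have 1 → 6 := fun h =>
    ⟨h.isLawsonSpaceOfMeetContinuousDomain, h.isMeetStable, h.isUpperT3Ordered⟩
  tfae_have 6 → 5 := fun h => ⟨h.1, h.2.1, h.2.2.isT2Ordered⟩
  tfae_have 5 → 4 := fun h => ⟨h.1, h.2.1, h.2.2.t2Space⟩
  tfae_have 4 → 1 := fun ⟨h, hs, _⟩ => h.isLawsonSpaceOfContinuousDomain hs
  tfae_have 1 → 8 := fun h =>
    ⟨h.isHyperconvex, h.isMcOrdered, h.isCoreStable, h.isT2Ordered.isPospace⟩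
  tfae_have 8 → 9 := fun h => ⟨h.1, h.2.1, h.2.2.1, h.2.2.2.isSemiPospace⟩
  tfae_have 9 → 1 := fun h => h.2.2.1.isLawsonSpaceOfContinuousDomain h.1 h.2.1 h.2.2.2
  tfae_have 1 → 13 := fun h =>
    ⟨h.isHyperconvex, h.isMcOrdered, h.isCoreStable.isUpStable, h.isDiamondStable, h.t3Space⟩
  tfae_have 13 → 10 := fun ⟨h, hm, hu, hs, _⟩ => ⟨h, hm, hu, hs, inferInstance⟩
  tfae_have 1 → 12 := fun h =>
    ⟨h.isHyperconvex, h.isMcOrdered, h.isCoreStable.isUpStable, h.isDiamondStable,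
      h.isUpperT3Ordered⟩
  tfae_have 12 → 11 := fun ⟨h, hm, hu, hs, ht⟩ => ⟨h, hm, hu, hs, ht.isT2Ordered⟩
  tfae_have 11 → 10 := fun ⟨h, hm, hu, hs, ht⟩ => ⟨h, hm, hu, hs, ht.t2Space⟩
  tfae_have 10 → 1 := fun ⟨h, hm, _, hs, _⟩ => hs.isLawsonSpaceOfContinuousDomain h hm
  tfae_finish
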